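/- Let $(\Omega,\Sigma,\nu)$ be a complete probability space, let $X$ and $Y$ be real Banach spaces, and let $T\colon X\to Y$ be a semi-embedding, i.e. an injective continuous linear map such that $T(B_X)$ is closed in $Y$, where $B_X=\{x\in X:\|x\|\le 1\}$. Suppose that - $X$ is weakly Lindelöf determined, i.e. the dual unit ball $B_{X^*}$ with the weak$^*$ topology is a Corson compact: it is homeomorphic to a set $K\subset[-1,1]^I$, for some non-empty set $I$, equipped with the product topology, such that $\{i\in I: k(i)\ne 0\}$ is countable for every $k\in K$; and - $Y$ has the $\nu$-Radon–Nikodým property ($\nu$-RNP). Then $X$ has the $\nu$-RNP. Here a Banach space $Z$ has the $\nu$-RNP if for every countably additive vector measure $m\colon\Sigma\to Z$ of bounded variation such that $m(A)=0$ for every $A\in\Sigma$ with $\nu(A)=0$, there is a Bochner $\nu$-integrable function $f\colon\Omega\to Z$ such that $m(A)=\int_A f\,d\nu$ for all $A\in\Sigma$. -/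

import Mathlib

open MeasureTheory

universe u v w

/-- An operator (continuous linear map) between real normed spaces is a *semi-embedding* if it is
injective and maps the closed unit ball onto a closed set. -/
def IsSemiEmbedding {X : Type u} {Y : Type v} [NormedAddCommGroup X] [NormedSpace ℝ X]
    [NormedAddCommGroup Y] [NormedSpace ℝ Y] (T : X →L[ℝ] Y) : Prop :=
  Function.Injective T ∧ IsClosed (T '' Metric.closedBall (0 : X) 1)

/-- A compact space is *Corson* if it is homeomorphic to a set `S ⊆ [-1,1]^I`, for some nonempty
set `I`, equipped with the product topology, all of whose elements have countable support.
(Discarding repeated coordinates, `I` may always be taken in the universe of `K`.) -/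
def IsCorsonCompact (K : Type u) [TopologicalSpace K] : Prop :=
  CompactSpace K ∧
    ∃ (I : Type u) (_ : Nonempty I) (S : Set (I → ℝ)),
      (∀ k ∈ S, ∀ i, k i ∈ Set.Icc (-1 : ℝ) 1) ∧
      (∀ k ∈ S, {i : I | k i ≠ 0}.Countable) ∧
      Nonempty (K ≃ₜ S)

/-- A real Banach space `X` is *weakly Lindelöf determined* if the closed unit ball of its dual,
with the weak* topology, is a Corson compact. -/
def IsWeaklyLindelofDetermined (X : Type u) [NormedAddCommGroup X] [NormedSpace ℝ X] : Prop :=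
  IsCorsonCompact
    {φ : WeakDual ℝ X // WeakDual.toStrongDual φ ∈ Metric.closedBall (0 : StrongDual ℝ X) 1}

/-- The *Radon–Nikodým property of `X` with respect to `ν`*: every countably additive `X`-valued
vector measure of bounded variation which vanishes on the `ν`-null measurable sets is the
indefinite Bochner integral of some `ν`-Bochner integrable function. -/
def HasRadonNikodymProperty {Ω : Type w} [MeasurableSpace Ω] (ν : Measure Ω)
    (X : Type u) [NormedAddCommGroup X] [NormedSpace ℝ X] : Prop :=
  ∀ m : VectorMeasure Ω X, m.variation Set.univ < ⊤ →
    (∀ A, MeasurableSet A → ν A = 0 → m A = 0) →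
    ∃ f : Ω → X, Integrable f ν ∧ ∀ A, MeasurableSet A → m A = ∫ ω in A, f ω ∂ν

/-!
Let `m` be an `X`-valued measure of bounded variation that vanishes on `ν`-null sets, and let `μ` be
its variation, so `μ ≪ ν`. The measure `T ∘ m` has a `ν`-density, hence, dividing by `dμ/dν`
(`Integrable.ae_eq_rnDeriv_smul_inv_smul`), a `μ`-density `k`. The averages
`T (m A) / μ A` belong to the closed set `T '' B_X`, and therefore so do almost all values of `k`
(`Integrable.ae_mem_of_forall_setAverage_mem`). What has to be seen is that `T⁻¹ ∘ k` is strongly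
measurable. Up to a null set `k` lives in a closed separable subspace `Y₀` of `Y`. If
`X₀ = T⁻¹ Y₀` is separable, then `T` restricted to `X₀` is a measurable embedding by the
Lusin–Souslin theorem, and the lift is measurable (`IsSemiEmbedding.exists_integrable_lift`);
it is bounded by `1`, so `dμ/dν • T⁻¹ ∘ k` is the required `ν`-density of `m`.

Separability of `X₀` is where `X` being weakly Lindelöf determined enters. The points of `X₀` are
separated by countably many functionals, namely the `φ ∘ T` with `φ` in a countable family that
separates `Y₀`. In a weakly Lindelöf determined space this forces separability
(`IsWeaklyLindelofDetermined.isSeparable_of_countable_separating`). Write `B` for the dual unit ball.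
A closing-off argument produces countable sets `N` of vectors and `M` of functionals, the latter
containing the given separating family, such that

* restrictions to `N` of members of `M ∩ B` are dense among restrictions of members of `B`, and
  likewise for the members of `B` that annihilate `X₀`;
* each Corson coordinate that is nonzero somewhere on `M` depends only on the values on `N`;
* `M` is closed under rational combinations.

Hence `F`, the weak* closure of `M ∩ B`, is compact and absolutely convex. Each member of `B` agrees
on `N` with a member of `F`, which is unique: the coordinates that vanish on `M` vanish on `F`, and
the remaining ones are determined by `N`. Since `N` separates `F`, a Hahn–Banach argument shows that
each `x` coincides on `F` with some `y` in the closed span of `N`. For `x ∈ X₀` the functionals that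
annihilate `X₀` annihilate `y` as well, so `y ∈ X₀`; as `F` contains a family separating the points
of `X₀`, it follows that `x = y`. Thus `X₀` is contained in the closed span of `N`.
-/

/-! ### Closing-off and compactness -/

/-- Closing off: a countable set can be enlarged to a countable set that is closed under a
countably-multivalued operation on finite subsets. -/
theorem Set.Countable.exists_countable_closed {Z : Type*} {S₀ : Set Z} (hS₀ : S₀.Countable)
    (Θ : Finset Z → Set Z) (hΘ : ∀ G, (Θ G).Countable) :
    ∃ S : Set Z, S.Countable ∧ S₀ ⊆ S ∧ ∀ G : Finset Z, (G : Set Z) ⊆ S → Θ G ⊆ S := by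
  classical
  let step : Set Z → Set Z := fun S => S ∪ ⋃ G ∈ {G : Finset Z | (G : Set Z) ⊆ S}, Θ G
  let A : ℕ → Set Z := fun n => step^[n] S₀
  have hA : ∀ n, A (n + 1) = step (A n) := fun n => Function.iterate_succ_apply' step n S₀
  have hmono : Monotone A := monotone_nat_of_le_succ fun n => by
    rw [hA]; exact Set.subset_union_left
  have hcount : ∀ n, (A n).Countable := by
    intro n
    induction n with
    | zero => exact hS₀
    | succ n ih =>
      rw [hA]
      refine ih.union (Set.Countable.biUnion ?_ fun G _ => hΘ G)
      exact ((Set.countable_ofPred_finite_subset ih).preimage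
        (Finset.coe_injective (α := Z))).mono fun G hG =>
          Set.mem_preimage.2 (Set.mem_ofPred_eq ▸ ⟨G.finite_toSet, hG⟩)
  refine ⟨⋃ n, A n, Set.countable_iUnion hcount, Set.subset_iUnion A 0, fun G hG => ?_⟩
  obtain ⟨n, hn⟩ : ∃ n, (G : Set Z) ⊆ A n :=
    hmono.directed_le.exists_mem_subset_of_finset_subset_biUnion hG
  refine Set.Subset.trans ?_ (Set.subset_iUnion A (n + 1))
  rw [hA]
  exact fun z hz => Or.inr (Set.mem_biUnion
    (show G ∈ {G : Finset Z | (G : Set Z) ⊆ A n} from hn) hz)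

/-- On a compact set whose points are separated by a family of continuous functions, each
continuous function depends on countably many members of the family. -/
theorem IsCompact.exists_countable_determining {E ι : Type*} [TopologicalSpace E] [T2Space E]
    {B : Set E} (hB : IsCompact B) (c : ι → E → ℝ) (hc : ∀ i, Continuous (c i))
    (hsep : ∀ u w, (∀ i, c i u = c i w) → u = w) {f : E → ℝ} (hf : ContinuousOn f B) :
    ∃ N : Set ι, N.Countable ∧ ∀ u ∈ B, ∀ w ∈ B, (∀ i ∈ N, c i u = c i w) → f u = f w := by
  have hBB : IsCompact (B ×ˢ B) := hB.prod hB
  have hff : ContinuousOn (fun p : E × E => |f p.1 - f p.2|) (B ×ˢ B) :=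
    ((hf.comp continuousOn_fst fun p hp => hp.1).sub
      (hf.comp continuousOn_snd fun p hp => hp.2)).abs
  have key : ∀ n : ℕ, ∃ t : Finset ι, (B ×ˢ B) ∩ (fun p : E × E => |f p.1 - f p.2|) ⁻¹'
      Set.Ici (1 / ((n : ℝ) + 1)) ⊆ ⋃ i ∈ t, {p : E × E | c i p.1 ≠ c i p.2} := by
    intro n
    refine IsCompact.elim_finite_subcover (hBB.of_isClosed_subset
      (hff.preimage_isClosed_of_isClosed hBB.isClosed isClosed_Ici) Set.inter_subset_left) _
      (fun i => isOpen_ne_fun ((hc i).comp continuous_fst) ((hc i).comp continuous_snd)) ?_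
    rintro ⟨u, w⟩ ⟨-, hp⟩
    by_contra hno
    simp only [Set.mem_iUnion, Set.mem_ofPred_eq, not_exists, not_not] at hno
    obtain rfl := hsep u w hno
    have : (1 / ((n : ℝ) + 1)) ≤ |f u - f u| := hp
    rw [sub_self, abs_zero] at this
    exact absurd this (not_le.2 Nat.one_div_pos_of_nat)
  choose t ht using key
  refine ⟨⋃ n, (t n : Set ι), Set.countable_iUnion fun n => (t n).countable_toSet, ?_⟩
  intro u hu w hw huw
  by_contra hne
  obtain ⟨n, hn⟩ := exists_nat_one_div_lt (abs_pos.2 (sub_ne_zero.2 hne))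
  have := ht n (show (u, w) ∈ _ from ⟨⟨hu, hw⟩, hn.le⟩)
  simp only [Set.mem_iUnion, Set.mem_ofPred_eq] at this
  obtain ⟨i, hi, hne'⟩ := this
  exact hne' (huw i (Set.mem_iUnion.2 ⟨n, hi⟩))

/-- Every set of functionals contains a countable subset that is dense in it for the topology of
pointwise convergence on a given finite set of vectors. -/
theorem WeakDual.exists_countable_approx {X : Type u} [NormedAddCommGroup X] [NormedSpace ℝ X]
    (G : Finset X) (C : Set (WeakDual ℝ X)) :
    ∃ c ⊆ C, c.Countable ∧ ∀ v ∈ C, ∀ ε > 0, ∃ u ∈ c, ∀ x ∈ G, |u x - v x| < ε := by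
  let R : WeakDual ℝ X → (G → ℝ) := fun u x => u x
  obtain ⟨t, htC, ht, hd⟩ := (TopologicalSpace.IsSeparable.of_separableSpace
    (R '' C)).exists_countable_dense_subset
  obtain ⟨p, hp, hRp⟩ : ∃ p : (G → ℝ) → WeakDual ℝ X,
      (∀ z ∈ t, p z ∈ C) ∧ ∀ z ∈ t, R (p z) = z := by
    choose! p hp using htC
    exact ⟨p, fun z hz => (hp hz).1, fun z hz => (hp hz).2⟩
  refine ⟨p '' t, Set.image_subset_iff.2 hp, ht.image p, fun v hv ε hε => ?_⟩
  obtain ⟨z, hz, hzd⟩ := Metric.mem_closure_iff.1 (hd (Set.mem_image_of_mem R hv)) ε hε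
  refine ⟨p z, Set.mem_image_of_mem p hz, fun x hx => ?_⟩
  have h1 := (dist_pi_lt_iff hε).1 hzd ⟨x, hx⟩
  rw [dist_comm, Real.dist_eq, ← hRp z hz] at h1
  exact h1

/-- If `A` approximates `v` on finite subsets of `N` and has compact weak* closure, then some
element of that closure coincides with `v` on `N`. -/
theorem WeakDual.exists_mem_closure_eqOn {X : Type u} [NormedAddCommGroup X] [NormedSpace ℝ X]
    {A : Set (WeakDual ℝ X)} (hA : IsCompact (closure A)) {N : Set X} {v : WeakDual ℝ X}
    (h : ∀ G : Finset X, (G : Set X) ⊆ N → ∀ ε > 0, ∃ u ∈ A, ∀ x ∈ G, |u x - v x| < ε) :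
    ∃ u ∈ closure A, ∀ x ∈ N, u x = v x := by
  classical
  have hne : (closure A ∩ ⋂ p : N × ℕ,
      {u : WeakDual ℝ X | |u p.1 - v p.1| ≤ 1 / ((p.2 : ℝ) + 1)}).Nonempty := by
    refine hA.inter_iInter_nonempty _ (fun p => isClosed_le
      ((WeakDual.eval_continuous (p.1 : X)).sub continuous_const).abs continuous_const) ?_
    intro s
    obtain ⟨u, hu, hux⟩ := h (s.image fun p => (p.1 : X)) (by
      intro x hx
      simp only [Finset.coe_image, Set.mem_image] at hx
      obtain ⟨p, -, rfl⟩ := hx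
      exact p.1.2) (1 / (((s.sup fun p => p.2 : ℕ) : ℝ) + 1)) Nat.one_div_pos_of_nat
    refine ⟨u, subset_closure hu, Set.mem_iInter₂.2 fun p hp => ?_⟩
    refine (hux p.1 (Finset.mem_image_of_mem _ hp)).le.trans ?_
    exact Nat.one_div_le_one_div (Finset.le_sup (f := fun p : N × ℕ => p.2) hp)
  obtain ⟨u, hu, hux⟩ := hne
  refine ⟨u, hu, fun x hx => ?_⟩
  by_contra hne
  obtain ⟨n, hn⟩ := exists_nat_one_div_lt (abs_pos.2 (sub_ne_zero.2 hne))
  exact absurd (Set.mem_iInter.1 hux (⟨x, hx⟩, n)) (not_le.2 hn)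

/-! ### Approximation by a spanning set on a compact set of functionals -/

/-- If `x` vanishes at those members of a weak* compact absolutely convex set `F` that annihilate
`N`, then `x` is uniformly approximable on `F` from the span of `N`. -/
theorem WeakDual.exists_span_approx {X : Type u} [NormedAddCommGroup X] [NormedSpace ℝ X]
    {F : Set (WeakDual ℝ X)} (hF : IsCompact F) (hconv : Convex ℝ F) (h0 : 0 ∈ F)
    (hneg : ∀ u ∈ F, -u ∈ F) {N : Set X} {x : X}
    (hx : ∀ u ∈ F, (∀ n ∈ N, u n = 0) → u x = 0) {ε : ℝ} (hε : 0 < ε) :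
    ∃ y ∈ Submodule.span ℝ N, ∀ u ∈ F, |u x - u y| ≤ ε := by
  classical
  -- By compactness finitely many vectors of `N` already prevent `u x = ε`.
  obtain ⟨s, hs⟩ := (hF.inter_right (isClosed_eq (WeakDual.eval_continuous x)
      (continuous_const (y := ε)))).elim_finite_subfamily_closed
    (fun n : N => {u : WeakDual ℝ X | u (n : X) = 0})
    (fun n => isClosed_eq (WeakDual.eval_continuous (n : X)) continuous_const) (by
      rw [Set.eq_empty_iff_forall_notMem]
      rintro u ⟨⟨huF, hux⟩, hu⟩
      have := hx u huF fun n hn => Set.mem_iInter.1 hu ⟨n, hn⟩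
      exact hε.ne' (hux.symm.trans this))
  let R : WeakDual ℝ X →ₗ[ℝ] (s → ℝ) × ℝ :=
    { toFun := fun u => (fun n => u (n : N), u x)
      map_add' := fun _ _ => rfl
      map_smul' := fun _ _ => rfl }
  have hRc : Continuous R := (continuous_pi fun n => WeakDual.eval_continuous _).prodMk
    (WeakDual.eval_continuous x)
  have hnot : ((0 : s → ℝ), ε) ∉ R '' F := by
    rintro ⟨u, hu, hRu⟩
    refine Set.eq_empty_iff_forall_notMem.1 hs u ⟨⟨hu, congrArg Prod.snd hRu⟩, ?_⟩
    refine Set.mem_iInter₂.2 fun n hn => ?_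
    exact congrFun (congrArg Prod.fst hRu) ⟨n, hn⟩
  -- Separating `(0, ε)` from the image of `F` produces the coefficients of `y`.
  obtain ⟨g, c, hgc, hcg⟩ := geometric_hahn_banach_closed_point
    (hconv.linear_image R) (hF.image hRc).isClosed hnot
  have hdec : ∀ (a : s → ℝ) (b : ℝ), g (a, b) =
      (∑ n, a n * g (Pi.single n 1, 0)) + b * g (0, 1) := by
    intro a b
    have h1 : (a, b) = (∑ n, a n • ((Pi.single n 1 : s → ℝ), (0 : ℝ))) + b • (0, 1) := by
      refine Prod.ext ?_ ?_
      · simp only [Prod.fst_add, Prod.fst_sum, Prod.smul_fst, smul_zero, add_zero]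
        exact pi_eq_sum_univ' a |>.trans (by simp)
      · simp [Prod.snd_sum]
    rw [h1, map_add, map_sum, map_smul]
    simp only [map_smul, smul_eq_mul]
  set b := g ((0 : s → ℝ), (1 : ℝ)) with hb
  have hc0 : 0 < c := by
    have := hgc _ (Set.mem_image_of_mem R h0)
    rwa [map_zero, map_zero] at this
  have hcb : c < ε * b := by
    have := hcg
    rw [hdec] at this
    simpa using this
  have hb0 : 0 < b := pos_of_mul_pos_right (hc0.trans hcb) hε.le
  refine ⟨-∑ n : s, (g (Pi.single n 1, 0) / b) • ((n : N) : X), ?_, ?_⟩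
  · exact neg_mem (sum_mem fun n _ => Submodule.smul_mem _ _ (Submodule.subset_span (n : N).2))
  · have key : ∀ u ∈ F, u x - u (-∑ n : s, (g (Pi.single n 1, 0) / b) • ((n : N) : X)) ≤ ε := by
      intro u hu
      have h1 := hgc _ (Set.mem_image_of_mem R hu)
      have h2 : g (R u) = (∑ n : s, u ((n : N) : X) * g (Pi.single n 1, 0)) + u x * b :=
        hdec _ _
      have h3 : u x - u (-∑ n : s, (g (Pi.single n 1, 0) / b) • ((n : N) : X)) = g (R u) / b := by
        rw [h2, map_neg, map_sum, sub_neg_eq_add, add_div, Finset.sum_div,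
          mul_div_cancel_right₀ _ hb0.ne', add_comm]
        congr 1
        refine Finset.sum_congr rfl fun n _ => ?_
        rw [map_smul, smul_eq_mul]; ring
      rw [h3, div_le_iff₀ hb0]
      linarith
    intro u hu
    refine abs_le.2 ⟨?_, key u hu⟩
    have h4 := key (-u) (hneg u hu)
    have h5 : ∀ z : X, (-u) z = -(u z) := fun z => rfl
    rw [h5, h5] at h4
    linarith

/-- When moreover `F` is norming on the span of `N`, the approximants converge in norm. -/
theorem WeakDual.exists_mem_closure_span_eqOn {X : Type u} [NormedAddCommGroup X]
    [NormedSpace ℝ X] [CompleteSpace X]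
    {F : Set (WeakDual ℝ X)} (hF : IsCompact F) (hconv : Convex ℝ F) (h0 : 0 ∈ F)
    (hneg : ∀ u ∈ F, -u ∈ F) {N : Set X}
    (hnorm : ∀ y ∈ Submodule.span ℝ N, ∃ u ∈ F, u y = ‖y‖) {x : X}
    (hx : ∀ u ∈ F, (∀ n ∈ N, u n = 0) → u x = 0) :
    ∃ y ∈ closure (Submodule.span ℝ N : Set X), ∀ u ∈ F, u x = u y := by
  choose y hyN hy using fun n : ℕ => WeakDual.exists_span_approx hF hconv h0 hneg hx
    (Nat.one_div_pos_of_nat (α := ℝ) (n := n))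
  have hlim : Filter.Tendsto (fun n : ℕ => 1 / ((n : ℝ) + 1)) Filter.atTop (nhds 0) :=
    tendsto_one_div_add_atTop_nhds_zero_nat
  have hcau : CauchySeq y := by
    refine cauchySeq_of_le_tendsto_0 (fun n => 1 / ((n : ℝ) + 1) + 1 / ((n : ℝ) + 1)) ?_
      (by simpa using hlim.add hlim)
    intro n m k hkn hkm
    obtain ⟨u, hu, hun⟩ := hnorm (y n - y m) (sub_mem (hyN n) (hyN m))
    rw [dist_eq_norm, ← hun, map_sub]
    have h1 := abs_le.1 ((hy n u hu).trans (Nat.one_div_le_one_div hkn))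
    have h2 := abs_le.1 ((hy m u hu).trans (Nat.one_div_le_one_div hkm))
    linarith [h1.1, h2.2]
  obtain ⟨z, hz⟩ := cauchySeq_tendsto_of_complete hcau
  refine ⟨z, mem_closure_of_tendsto hz (Filter.Eventually.of_forall hyN), fun u hu => ?_⟩
  have h1 : Filter.Tendsto (fun n => |u x - u (y n)|) Filter.atTop (nhds |u x - u z|) :=
    (tendsto_const_nhds.sub ((map_continuous u).tendsto z |>.comp hz)).abs
  have h2 := le_of_tendsto_of_tendsto' h1 hlim fun n => hy n u hu
  exact sub_eq_zero.1 (abs_nonpos_iff.1 h2)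

/-! ### Separability of subspaces with a countable separating set of functionals -/

/-- A weakly Lindelöf determined space comes with weak* continuous coordinates on the dual unit ball
that separate its points and of which each functional sees only countably many. -/
theorem IsWeaklyLindelofDetermined.exists_coordinates {X : Type u} [NormedAddCommGroup X]
    [NormedSpace ℝ X] (hX : IsWeaklyLindelofDetermined X) :
    ∃ (I : Type u) (h : I → WeakDual ℝ X → ℝ),
      (∀ i, ContinuousOn (h i) (WeakDual.toStrongDual ⁻¹' Metric.closedBall 0 1)) ∧
      (∀ u, {i | h i u ≠ 0}.Countable) ∧
      ∀ u ∈ WeakDual.toStrongDual ⁻¹' Metric.closedBall (0 : StrongDual ℝ X) 1,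
        ∀ w ∈ WeakDual.toStrongDual ⁻¹' Metric.closedBall (0 : StrongDual ℝ X) 1,
          (∀ i, h i u = h i w) → u = w := by
  classical
  obtain ⟨-, I, -, S, -, hS, ⟨e⟩⟩ := hX
  refine ⟨I, fun i u => if hu : WeakDual.toStrongDual u ∈ Metric.closedBall 0 1 then
    (e ⟨u, hu⟩ : I → ℝ) i else 0, fun i => ?_, fun u => ?_, fun u hu w hw huw => ?_⟩
  · rw [continuousOn_iff_continuous_domRestrict]
    have h1 : Continuous fun u => (e u : I → ℝ) i :=
      (continuous_apply i).comp (continuous_subtype_val.comp e.continuous)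
    have h2 : ∀ u : {u : WeakDual ℝ X // WeakDual.toStrongDual u ∈ Metric.closedBall 0 1},
        (e u : I → ℝ) i = if hu : WeakDual.toStrongDual (u : WeakDual ℝ X) ∈ Metric.closedBall 0 1
          then (e ⟨u, hu⟩ : I → ℝ) i else 0 := fun u => by
      rw [dif_pos u.2]
    exact h1.congr h2
  · by_cases hu : WeakDual.toStrongDual u ∈ Metric.closedBall 0 1
    · simpa only [hu, dif_pos] using hS _ (e ⟨u, hu⟩).2
    · simp only [hu, dif_neg, not_false_eq_true, ne_eq, not_true_eq_false]
      exact Set.countable_empty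
  · have h1 : e ⟨u, hu⟩ = e ⟨w, hw⟩ := by
      refine Subtype.ext (funext fun i => ?_)
      have := huw i
      beta_reduce at this
      rwa [dif_pos (show WeakDual.toStrongDual u ∈ Metric.closedBall 0 1 from hu),
        dif_pos (show WeakDual.toStrongDual w ∈ Metric.closedBall 0 1 from hw)] at this
    exact congrArg Subtype.val (e.injective h1)

/-- A set closed under the rational combinations `q • a + p • b` with `|q| + |p| ≤ 1` has convex
closure. -/
theorem convex_closure_of_rat_combination {E : Type*} [AddCommGroup E] [Module ℝ E]
    [TopologicalSpace E] [ContinuousAdd E] [ContinuousSMul ℝ E] {A : Set E}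
    (hA : ∀ a ∈ A, ∀ b ∈ A, ∀ q p : ℚ, |(q : ℝ)| + |(p : ℝ)| ≤ 1 →
      (q : ℝ) • a + (p : ℝ) • b ∈ A) : Convex ℝ (closure A) := by
  rw [convex_iff_forall_pos]
  intro x hx y hy s t hs ht hst
  have hsI : s ∈ closure (Set.Ioo (0 : ℝ) 1 ∩ Set.range ((↑) : ℚ → ℝ)) :=
    (Rat.denseRange_cast (𝕜 := ℝ)).open_subset_closure_inter isOpen_Ioo ⟨hs, by linarith⟩
  have hmem : (s, (x, y)) ∈ closure ((Set.Ioo (0 : ℝ) 1 ∩ Set.range ((↑) : ℚ → ℝ)) ×ˢ (A ×ˢ A)) := by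
    rw [closure_prod_eq, closure_prod_eq]
    exact ⟨hsI, hx, hy⟩
  have hcont : Continuous fun p : ℝ × E × E => p.1 • p.2.1 + (1 - p.1) • p.2.2 := by fun_prop
  have := map_mem_closure hcont hmem (t := A) (by
    rintro ⟨r, a, b⟩ ⟨⟨hr, q, rfl⟩, ha, hb⟩
    have h1 := hA a ha b hb q (1 - q) (by
      push_cast
      rw [abs_of_pos hr.1, abs_of_pos (by linarith [hr.2])]
      linarith)
    push_cast at h1
    exact h1)
  rwa [show t = 1 - s by linarith]

/-- In a weakly Lindelöf determined Banach space, a closed subspace whose points are separated by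
countably many functionals is separable. The closing-off argument produces a countable set `N` of
vectors and a countable set `M` of functionals such that the weak* closure `F` of the part of `M`
in the dual ball is mapped bijectively onto the restrictions to `N` of the dual ball; surjectivity
comes from density of `M`, injectivity from the countable supports. -/
theorem IsWeaklyLindelofDetermined.isSeparable_of_countable_separating {X : Type u}
    [NormedAddCommGroup X] [NormedSpace ℝ X] [CompleteSpace X]
    (hX : IsWeaklyLindelofDetermined X) (X₀ : Submodule ℝ X) (hX₀ : IsClosed (X₀ : Set X))
    {D : Set (StrongDual ℝ X)} (hD : D.Countable) (hDn : ∀ φ ∈ D, ‖φ‖ ≤ 1)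
    (hsep : ∀ x ∈ X₀, (∀ φ ∈ D, φ x = 0) → x = 0) :
    TopologicalSpace.IsSeparable (X₀ : Set X) := by
  classical
  obtain ⟨I, h, hcont, hsupp, hinj⟩ := hX.exists_coordinates
  set B : Set (WeakDual ℝ X) := WeakDual.toStrongDual ⁻¹' Metric.closedBall 0 1 with hBdef
  have hmemB : ∀ u : WeakDual ℝ X, u ∈ B ↔ ‖WeakDual.toStrongDual u‖ ≤ 1 := fun u => by
    rw [hBdef, Set.mem_preimage, mem_closedBall_zero_iff]
  have hB : IsCompact B := WeakDual.isCompact_closedBall 0 1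
  let C : Set (WeakDual ℝ X) := B ∩ ⋂ x : X₀, {u | u (x : X) = 0}
  have hC : IsClosed C := hB.isClosed.inter (isClosed_iInter fun x =>
    isClosed_eq (WeakDual.eval_continuous (x : X)) continuous_const)
  choose Nc hNc hNcdet using fun i => hB.exists_countable_determining
    (fun (x : X) (u : WeakDual ℝ X) => u x) (fun x => WeakDual.eval_continuous x)
    (fun u w huw => DFunLike.ext _ _ huw) (hcont i)
  choose a haB hac ha using fun G : Finset X => WeakDual.exists_countable_approx G B
  choose b hbC hbc hb using fun G : Finset X => WeakDual.exists_countable_approx G C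
  -- Vectors and functionals are closed off together. Finite sets of vectors contribute approximants
  -- of `B` and of `C` (the members of `B` annihilating `X₀`); functionals contribute their rational
  -- combinations, and the vectors that determine the coordinates in their supports.
  let Θ : Finset (X ⊕ WeakDual ℝ X) → Set (X ⊕ WeakDual ℝ X) := fun G =>
    Sum.inr '' (a G.toLeft ∪ b G.toLeft ∪ ⋃ (q : ℚ) (p : ℚ) (v ∈ G.toRight) (w ∈ G.toRight),
      {(q : ℝ) • v + (p : ℝ) • w}) ∪
    Sum.inl '' (⋃ (v ∈ G.toRight) (i ∈ {i | h i v ≠ 0}), Nc i)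
  have hΘ : ∀ G, (Θ G).Countable := fun G => by
    refine Set.Countable.union (Set.Countable.image (((hac _).union (hbc _)).union ?_) _)
      (Set.Countable.image ?_ _)
    · refine Set.countable_iUnion fun q => Set.countable_iUnion fun p => ?_
      refine G.toRight.countable_toSet.biUnion fun v _ => ?_
      exact G.toRight.countable_toSet.biUnion fun w _ => Set.countable_singleton _
    · exact G.toRight.countable_toSet.biUnion fun v _ => (hsupp v).biUnion fun i _ => hNc i
  obtain ⟨S, hS, hS₀, hSΘ⟩ := Set.Countable.exists_countable_closed
    (S₀ := Sum.inr '' insert 0 (WeakDual.toStrongDual ⁻¹' D))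
    (((hD.preimage WeakDual.toStrongDual.injective).insert 0).image _) Θ hΘ
  let N : Set X := Sum.inl ⁻¹' S
  let M : Set (WeakDual ℝ X) := Sum.inr ⁻¹' S
  have hNcount : N.Countable := hS.preimage Sum.inl_injective
  -- The closure properties of `N` and `M`.
  have hleft : ∀ G : Finset X, (G : Set X) ⊆ N → a G ⊆ M ∧ b G ⊆ M := by
    intro G hG
    have h1 := hSΘ (G.disjSum ∅) (by
      intro z hz
      obtain ⟨x, hx, rfl⟩ | ⟨x, hx, rfl⟩ := Finset.mem_disjSum.1 (Finset.mem_coe.1 hz)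
      · exact hG hx
      · simp at hx)
    have h2 : (G.disjSum (∅ : Finset (WeakDual ℝ X))).toLeft = G := by
      ext; simp
    constructor
    · intro v hv
      exact h1 (Or.inl ⟨v, Or.inl (Or.inl (h2.symm ▸ hv)), rfl⟩)
    · intro v hv
      exact h1 (Or.inl ⟨v, Or.inl (Or.inr (h2.symm ▸ hv)), rfl⟩)
  have hrat : ∀ v ∈ M, ∀ w ∈ M, ∀ q p : ℚ, (q : ℝ) • v + (p : ℝ) • w ∈ M := by
    intro v hv w hw q p
    refine hSΘ {Sum.inr v, Sum.inr w} ?_ (Or.inl ⟨_, Or.inr ?_, rfl⟩)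
    · intro z hz
      simp only [Finset.coe_insert, Finset.coe_singleton, Set.mem_insert_iff,
        Set.mem_singleton_iff] at hz
      obtain rfl | rfl := hz
      exacts [hv, hw]
    · simp only [Set.mem_iUnion]
      exact ⟨q, p, v, by simp, w, by simp, rfl⟩
  have hdet : ∀ v ∈ M, ∀ i, h i v ≠ 0 → Nc i ⊆ N := by
    intro v hv i hi x hx
    refine hSΘ {Sum.inr v} ?_ (Or.inr ⟨x, ?_, rfl⟩)
    · intro z hz
      rw [Finset.coe_singleton, Set.mem_singleton_iff] at hz
      exact hz ▸ hv
    · simp only [Set.mem_iUnion]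
      exact ⟨v, by simp, i, hi, hx⟩
  let F : Set (WeakDual ℝ X) := closure (M ∩ B)
  have hFB : F ⊆ B := closure_minimal Set.inter_subset_right hB.isClosed
  have hF : IsCompact F := hB.of_isClosed_subset isClosed_closure hFB
  have hMF : M ∩ B ⊆ F := subset_closure
  have h0B : (0 : WeakDual ℝ X) ∈ B := by rw [hmemB, map_zero, norm_zero]; exact zero_le_one
  have h0F : (0 : WeakDual ℝ X) ∈ F :=
    hMF ⟨hS₀ (Set.mem_image_of_mem _ (Set.mem_insert _ _)), h0B⟩
  have hcomb : ∀ v ∈ M ∩ B, ∀ w ∈ M ∩ B, ∀ q p : ℚ, |(q : ℝ)| + |(p : ℝ)| ≤ 1 →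
      (q : ℝ) • v + (p : ℝ) • w ∈ M ∩ B := by
    intro v hv w hw q p hqp
    refine ⟨hrat v hv.1 w hw.1 q p, (hmemB _).2 ?_⟩
    have hv1 := (hmemB v).1 hv.2
    have hw1 := (hmemB w).1 hw.2
    rw [map_add, map_smul, map_smul]
    refine (norm_add_le _ _).trans ?_
    rw [norm_smul, norm_smul, Real.norm_eq_abs, Real.norm_eq_abs]
    exact (add_le_add (mul_le_of_le_one_right (abs_nonneg _) hv1)
      (mul_le_of_le_one_right (abs_nonneg _) hw1)).trans hqp
  have hFconv : Convex ℝ F := convex_closure_of_rat_combination hcomb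
  have hFneg : ∀ u ∈ F, -u ∈ F := fun u hu => map_mem_closure continuous_neg hu fun v hv => by
    have := hcomb v hv v hv (-1) 0 (by simp)
    simpa using this
  -- The coordinates not supported on `M` vanish on `F`, the others are determined by `N`.
  have hFinj : ∀ u ∈ F, ∀ w ∈ F, (∀ n ∈ N, u n = w n) → u = w := by
    intro u hu w hw huw
    refine hinj u (hFB hu) w (hFB hw) fun i => ?_
    by_cases hi : ∃ v ∈ M, h i v ≠ 0
    · obtain ⟨v, hv, hvi⟩ := hi
      exact hNcdet i u (hFB hu) w (hFB hw) fun x hx => huw x (hdet v hv i hvi hx)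
    · push Not at hi
      have hz : ∀ u ∈ F, h i u = 0 := fun u hu => by
        have h1 : Set.MapsTo (h i) (M ∩ B) {0} := fun v hv => hi v hv.1
        have h2 := h1.closure_of_continuousOn ((hcont i).mono hFB) hu
        rwa [closure_singleton] at h2
      rw [hz u hu, hz w hw]
  have hFsurj : ∀ v ∈ B, ∃ u ∈ F, ∀ x ∈ N, u x = v x := fun v hv =>
    WeakDual.exists_mem_closure_eqOn hF fun G hG ε hε => by
      obtain ⟨u, hu, hux⟩ := ha G v hv ε hε
      exact ⟨u, ⟨(hleft G hG).1 hu, haB G hu⟩, hux⟩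
  have hCF : closure (M ∩ C) ⊆ F := closure_mono (Set.inter_subset_inter_right _
    Set.inter_subset_left)
  have hCsurj : ∀ v ∈ C, ∃ u ∈ F ∩ C, ∀ x ∈ N, u x = v x := fun v hv => by
    obtain ⟨u, hu, hux⟩ := WeakDual.exists_mem_closure_eqOn
      (hF.of_isClosed_subset isClosed_closure hCF) (A := M ∩ C) (N := N) (v := v)
      fun G hG ε hε => by
        obtain ⟨u, hu, hux⟩ := hb G v hv ε hε
        exact ⟨u, ⟨(hleft G hG).2 hu, hbC G hu⟩, hux⟩
    exact ⟨u, ⟨hCF hu, closure_minimal Set.inter_subset_right hC hu⟩, hux⟩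
  have hspan : ∀ u v : WeakDual ℝ X, (∀ x ∈ N, u x = v x) →
      ∀ y ∈ closure (Submodule.span ℝ N : Set X), u y = v y := by
    intro u v huv y hy
    have h1 : Set.EqOn u v (Submodule.span ℝ N : Set X) := fun z hz =>
      LinearMap.eqOn_span (f := (WeakDual.toStrongDual u : X →ₗ[ℝ] ℝ))
        (g := (WeakDual.toStrongDual v : X →ₗ[ℝ] ℝ)) huv hz
    exact h1.closure (map_continuous u) (map_continuous v) hy
  have hnorm : ∀ y ∈ Submodule.span ℝ N, ∃ u ∈ F, u y = ‖y‖ := by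
    intro y hy
    obtain ⟨g, hg1, hgy⟩ := exists_dual_vector'' ℝ y
    obtain ⟨u, hu, hux⟩ := hFsurj (StrongDual.toWeakDual g) ((hmemB _).2 hg1)
    exact ⟨u, hu, (hspan u _ hux y (subset_closure hy)).trans hgy⟩
  have hsub : (X₀ : Set X) ⊆ closure (Submodule.span ℝ N : Set X) := by
    intro x hx
    obtain ⟨y, hy, hxy⟩ := WeakDual.exists_mem_closure_span_eqOn hF hFconv h0F hFneg hnorm
      (x := x) fun u hu hun => by
        rw [hFinj u hu 0 h0F hun]; rfl
    -- Functionals in the ball that vanish on `X₀` also vanish at `y`.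
    have hyC : ∀ v ∈ C, v y = 0 := by
      intro v hv
      obtain ⟨u, ⟨huF, huC⟩, huv⟩ := hCsurj v hv
      rw [← hspan u v huv y hy, ← hxy u huF]
      exact Set.mem_iInter.1 huC.2 ⟨x, hx⟩
    have hyX₀ : y ∈ X₀ := by
      by_contra hy₀
      obtain ⟨g, hg1, hgy, hg0⟩ : ∃ g : StrongDual ℝ X, ‖g‖ ≤ 1 ∧ g y ≠ 0 ∧ ∀ z ∈ X₀, g z = 0 := by
        obtain ⟨f, c, hfy, hfX⟩ := geometric_hahn_banach_point_closed X₀.convex hX₀ hy₀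
        have hf0 : ∀ z ∈ X₀, f z = 0 := by
          intro z hz
          by_contra hne
          have h1 := hfX _ (X₀.smul_mem (c / f z) hz)
          rw [map_smul, smul_eq_mul, div_mul_cancel₀ _ hne] at h1
          exact lt_irrefl _ h1
        have hfy0 : f y ≠ 0 := by
          have h1 := hfX 0 X₀.zero_mem
          rw [map_zero] at h1
          exact (hfy.trans h1).ne
        have hfn : ‖f‖ ≠ 0 := fun hf => hfy0 (by rw [norm_eq_zero.1 hf]; rfl)
        refine ⟨‖f‖⁻¹ • f, ?_, mul_ne_zero (inv_ne_zero hfn) hfy0, fun z hz => ?_⟩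
        · rw [norm_smul, norm_inv, norm_norm, inv_mul_cancel₀ hfn]
        · exact (congrArg (‖f‖⁻¹ * ·) (hf0 z hz)).trans (mul_zero _)
      exact hgy (hyC (StrongDual.toWeakDual g) ⟨(hmemB _).2 hg1,
        Set.mem_iInter.2 fun z => hg0 z z.2⟩)
    have hxy0 : x - y = 0 := hsep _ (sub_mem hx hyX₀) fun φ hφ => by
      have h1 : StrongDual.toWeakDual φ ∈ F :=
        hMF ⟨hS₀ (Set.mem_image_of_mem _ (Set.mem_insert_of_mem _ hφ)), (hmemB _).2 (hDn φ hφ)⟩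
      rw [map_sub, sub_eq_zero]
      exact hxy _ h1
    rwa [sub_eq_zero.1 hxy0]
  exact (hNcount.isSeparable.span (R := ℝ)).closure.mono hsub

/-! ### Lifting densities along a semi-embedding -/

/-- A separable set of vectors has countably many functionals in the dual ball separating its
elements from zero. -/
theorem TopologicalSpace.IsSeparable.exists_countable_dual_separating {Y : Type v}
    [NormedAddCommGroup Y] [NormedSpace ℝ Y] {s : Set Y} (hs : TopologicalSpace.IsSeparable s) :
    ∃ D : Set (StrongDual ℝ Y), D.Countable ∧ (∀ φ ∈ D, ‖φ‖ ≤ 1) ∧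
      ∀ y ∈ s, (∀ φ ∈ D, φ y = 0) → y = 0 := by
  obtain ⟨t, ht, hst⟩ := hs
  choose φ hφ1 hφ using fun y : Y => exists_dual_vector'' ℝ y
  refine ⟨φ '' t, ht.image φ, Set.forall_mem_image.2 fun y _ => hφ1 y, fun y hy hyD => ?_⟩
  by_contra hy0
  obtain ⟨z, hz, hyz⟩ := Metric.mem_closure_iff.1 (hst hy) (‖y‖ / 2) (half_pos (norm_pos_iff.2 hy0))
  have h1 : φ z (z - y) = ‖z‖ := by
    rw [map_sub, hyD _ (Set.mem_image_of_mem φ hz), sub_zero]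
    exact hφ z
  have h2 : ‖z‖ ≤ ‖z - y‖ := by
    rw [← h1]
    refine (le_abs_self _).trans (((φ z).le_opNorm _).trans ?_)
    exact mul_le_of_le_one_left (norm_nonneg _) (hφ1 z)
  have h3 := norm_sub_norm_le y z
  rw [dist_eq_norm] at hyz
  rw [norm_sub_rev] at h2
  linarith

/-- An integrable function whose averages over all sets of positive measure belong to a closed set
takes almost all of its values in that set. -/
theorem MeasureTheory.Integrable.ae_mem_of_forall_setAverage_mem {Ω : Type w} [MeasurableSpace Ω]
    {μ : Measure Ω} [IsFiniteMeasure μ] {Y : Type v} [NormedAddCommGroup Y] [NormedSpace ℝ Y]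
    [CompleteSpace Y] {f : Ω → Y} (hf : Integrable f μ) {C : Set Y} (hC : IsClosed C)
    (havg : ∀ A, MeasurableSet A → μ A ≠ 0 → (⨍ ω in A, f ω ∂μ) ∈ C) : ∀ᵐ ω ∂μ, f ω ∈ C := by
  have hfm := hf.aestronglyMeasurable
  set g := hfm.mk f with hg
  have hgm : StronglyMeasurable g := hfm.stronglyMeasurable_mk
  have hfg : f =ᵐ[μ] g := hfm.ae_eq_mk
  obtain ⟨t, ht, htd⟩ := hgm.isSeparable_range
  have := ht.to_subtype
  -- A small ball missing `C` has null preimage, as otherwise it would contain an average.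
  have hball : ∀ᵐ ω ∂μ, ∀ (y : t) (n : ℕ),
      Disjoint (Metric.closedBall (y : Y) (1 / ((n : ℝ) + 1))) C →
        g ω ∉ Metric.closedBall (y : Y) (1 / ((n : ℝ) + 1)) := by
    rw [ae_all_iff]
    intro y
    rw [ae_all_iff]
    intro n
    rw [Filter.eventually_imp_distrib_left]
    intro hdisj
    set A := g ⁻¹' Metric.closedBall (y : Y) (1 / ((n : ℝ) + 1)) with hA
    have hAm : MeasurableSet A :=
      measurableSet_le (hgm.dist stronglyMeasurable_const).measurable measurable_const
    have hA0 : μ A = 0 := by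
      by_contra hne
      refine Set.disjoint_left.1 hdisj ?_ (havg A hAm hne)
      refine (convex_closedBall _ _).set_average_mem Metric.isClosed_closedBall hne
        (measure_ne_top _ _) ?_ hf.integrableOn
      filter_upwards [ae_restrict_mem hAm, ae_restrict_of_ae hfg] with ω h1 h2
      rw [h2]; exact h1
    exact measure_eq_zero_iff_ae_notMem.1 hA0
  filter_upwards [hball, hfg] with ω hω hfω
  rw [hfω]
  by_contra hgC
  obtain ⟨r, hr, hrC⟩ := Metric.isOpen_iff.1 hC.isOpen_compl _ hgC
  obtain ⟨n, hn⟩ := exists_nat_one_div_lt (half_pos hr)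
  obtain ⟨y, hy, hyd⟩ := Metric.mem_closure_iff.1 (htd (Set.mem_range_self ω)) _
    (Nat.one_div_pos_of_nat (α := ℝ) (n := n))
  refine hω ⟨y, hy⟩ n (Set.disjoint_left.2 fun z hz hzC => hrC ?_ hzC) hyd.le
  have h1 := dist_triangle z y (g ω)
  have h2 : dist z y ≤ 1 / ((n : ℝ) + 1) := hz
  rw [dist_comm y] at h1
  exact Metric.mem_ball.2 (by linarith)

/-- Densities lift along semi-embeddings of weakly Lindelöf determined spaces: if `m` is dominated
in norm by `μ` and `T ∘ m` has a density `k`, then `k` takes almost all values in `T '' B_X`, and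
`T⁻¹ ∘ k` is a density of `m`. It is strongly measurable by the Lusin–Souslin theorem, because `k`
is essentially separably valued and so is then its lift. -/
theorem IsSemiEmbedding.exists_integrable_lift {Ω : Type w} [MeasurableSpace Ω]
    {X : Type u} [NormedAddCommGroup X] [NormedSpace ℝ X] [CompleteSpace X]
    {Y : Type v} [NormedAddCommGroup Y] [NormedSpace ℝ Y] [CompleteSpace Y]
    {T : X →L[ℝ] Y} (hT : IsSemiEmbedding T) (hX : IsWeaklyLindelofDetermined X)
    {μ : Measure Ω} [IsFiniteMeasure μ] {m : Set Ω → X} (hm : ∀ A, ‖m A‖ ≤ μ.real A)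
    {k : Ω → Y} (hk : Integrable k μ)
    (hmk : ∀ A, MeasurableSet A → T (m A) = ∫ ω in A, k ω ∂μ) :
    ∃ f : Ω → X, Integrable f μ ∧ ∀ A, MeasurableSet A → m A = ∫ ω in A, f ω ∂μ := by
  have hball : ∀ᵐ ω ∂μ, k ω ∈ T '' Metric.closedBall (0 : X) 1 := by
    refine hk.ae_mem_of_forall_setAverage_mem hT.2 fun A hA hA0 => ?_
    rw [setAverage_eq, ← hmk A hA, ← map_smul]
    refine Set.mem_image_of_mem _ (mem_closedBall_zero_iff.2 ?_)
    have hpos : 0 < μ.real A := ENNReal.toReal_pos hA0 (measure_ne_top _ _)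
    rw [norm_smul, norm_inv, Real.norm_of_nonneg hpos.le]
    exact inv_mul_le_one_of_le₀ (hm A) hpos.le
  have hkm := hk.aestronglyMeasurable
  set g := hkm.mk k with hg
  have hgm : StronglyMeasurable g := hkm.stronglyMeasurable_mk
  have hkg : k =ᵐ[μ] g := hkm.ae_eq_mk
  let Y₀ : Submodule ℝ Y := (Submodule.span ℝ (Set.range g)).topologicalClosure
  have hY₀ : TopologicalSpace.IsSeparable (Y₀ : Set Y) :=
    (hgm.isSeparable_range.span (R := ℝ)).closure
  let X₀ : Submodule ℝ X := Y₀.comap (T : X →ₗ[ℝ] Y)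
  have hX₀ : IsClosed (X₀ : Set X) :=
    (Submodule.isClosed_topologicalClosure _).preimage T.continuous
  obtain ⟨D, hD, hD1, hDsep⟩ := hY₀.exists_countable_dual_separating
  have hX₀sep : TopologicalSpace.IsSeparable (X₀ : Set X) := by
    have hpos : 0 < ‖T‖ + 1 := by positivity
    refine hX.isSeparable_of_countable_separating X₀ hX₀
      (D := (fun φ : StrongDual ℝ Y => (‖T‖ + 1)⁻¹ • φ.comp T) '' D) (hD.image _) ?_ ?_
    · rintro _ ⟨φ, hφ, rfl⟩
      rw [norm_smul, norm_inv, Real.norm_of_nonneg hpos.le]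
      refine inv_mul_le_one_of_le₀ ((φ.opNorm_comp_le T).trans ?_) hpos.le
      have := mul_le_of_le_one_left (norm_nonneg T) (hD1 φ hφ)
      linarith
    · intro x hx hxD
      have h1 : T x = 0 := hDsep _ hx fun φ hφ => by
        have := hxD _ (Set.mem_image_of_mem _ hφ)
        exact (mul_eq_zero.1 this).resolve_left (inv_ne_zero hpos.ne')
      exact hT.1 (h1.trans (map_zero T).symm)
  have : TopologicalSpace.SeparableSpace X₀ := hX₀sep.separableSpace
  have : TopologicalSpace.SeparableSpace Y₀ := hY₀.separableSpace
  have : CompleteSpace X₀ := hX₀.completeSpace_coe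
  have : SecondCountableTopology X₀ := UniformSpace.secondCountable_of_separable X₀
  borelize X
  borelize Y
  let T₀ : X₀ → Y₀ := fun x => ⟨T x, x.2⟩
  have hT₀c : Continuous T₀ := (T.continuous.comp continuous_subtype_val).subtype_mk _
  have hT₀i : Function.Injective T₀ := fun x y hxy =>
    Subtype.ext (hT.1 (congrArg Subtype.val hxy))
  have hT₀ : MeasurableEmbedding T₀ := hT₀c.measurableEmbedding hT₀i
  have hgY₀ : ∀ ω, g ω ∈ Y₀ := fun ω =>
    Submodule.le_topologicalClosure _ (Submodule.subset_span (Set.mem_range_self ω))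
  let g₀ : Ω → Y₀ := fun ω => ⟨g ω, hgY₀ ω⟩
  have hg₀ : Measurable g₀ := hgm.measurable.subtype_mk
  let f : Ω → X := fun ω => (Function.extend T₀ id (fun _ => 0) (g₀ ω) : X₀)
  have hfm : StronglyMeasurable f := continuous_subtype_val.comp_stronglyMeasurable
    ((hT₀.measurable_extend measurable_id measurable_const).comp hg₀).stronglyMeasurable
  have hf : ∀ᵐ ω ∂μ, ‖f ω‖ ≤ 1 ∧ T (f ω) = k ω := by
    filter_upwards [hball, hkg] with ω h1 h2
    obtain ⟨x, hx, hxk⟩ := h1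
    have hxg : T x = g ω := hxk.trans h2
    have hx₀ : x ∈ X₀ := by
      change T x ∈ Y₀
      rw [hxg]; exact hgY₀ ω
    have h3 : f ω = x := by
      have h4 : g₀ ω = T₀ ⟨x, hx₀⟩ := Subtype.ext hxg.symm
      change ((Function.extend T₀ id (fun _ => 0) (g₀ ω) : X₀) : X) = x
      rw [h4, hT₀i.extend_apply]; rfl
    rw [h3]
    exact ⟨mem_closedBall_zero_iff.1 hx, hxk⟩
  have hfi : Integrable f μ := Integrable.of_bound hfm.aestronglyMeasurable 1
    (hf.mono fun _ h => h.1)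
  refine ⟨f, hfi, fun A hA => hT.1 ?_⟩
  rw [hmk A hA, ← T.integral_comp_comm hfi.integrableOn]
  exact integral_congr_ae (ae_restrict_of_ae (hf.mono fun _ h => h.2.symm))

/-! ### Changing the reference measure to the variation -/

theorem MeasureTheory.VectorMeasure.variation_absolutelyContinuous {Ω : Type w} [MeasurableSpace Ω]
    {ν : Measure Ω} {X : Type u} [NormedAddCommGroup X] {m : VectorMeasure Ω X}
    (h : ∀ A, MeasurableSet A → ν A = 0 → m A = 0) : m.variation ≪ ν :=
  Measure.AbsolutelyContinuous.mk fun _ hs hs0 => (variation_apply_eq_zero hs).2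
    fun A hAs hA => h A hA (measure_mono_null hAs hs0)

/-- A `ν`-integrable `g` that has zero integral over the `μ`-null sets is, as a density, transported
from `ν` to `μ ≪ ν` on dividing by the density of `μ`. -/
theorem MeasureTheory.Integrable.ae_eq_rnDeriv_smul_inv_smul {Ω : Type w} [MeasurableSpace Ω]
    {μ ν : Measure Ω} [IsFiniteMeasure μ] [SigmaFinite ν] (hμν : μ ≪ ν)
    {Y : Type v} [NormedAddCommGroup Y] [NormedSpace ℝ Y] [CompleteSpace Y]
    {g : Ω → Y} (hg : Integrable g ν)
    (hg0 : ∀ A, MeasurableSet A → μ A = 0 → ∫ ω in A, g ω ∂ν = 0) :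
    (fun ω => (μ.rnDeriv ν ω).toReal • (μ.rnDeriv ν ω).toReal⁻¹ • g ω) =ᵐ[ν] g := by
  -- `μ` does not charge the zero set of its density, so `g` vanishes almost everywhere there.
  set Z := {ω | μ.rnDeriv ν ω = 0} with hZdef
  have hZ : MeasurableSet Z := Measure.measurable_rnDeriv μ ν (measurableSet_singleton 0)
  have hμZ : μ Z = 0 := measure_eq_zero_iff_ae_notMem.2
    ((Measure.rnDeriv_pos hμν).mono fun ω h1 h2 => h1.ne' h2)
  have hind : Z.indicator g =ᵐ[ν] 0 :=
    (hg.indicator hZ).ae_eq_zero_of_forall_setIntegral_eq_zero fun A hA _ => by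
      rw [setIntegral_indicator hZ]
      exact hg0 _ (hA.inter hZ) (measure_mono_null Set.inter_subset_right hμZ)
  filter_upwards [hind, Measure.rnDeriv_ne_top μ ν] with ω h1 h2
  by_cases hω : ω ∈ Z
  · rw [Set.indicator_of_mem hω] at h1
    rw [h1]; simp
  · exact smul_inv_smul₀ (ENNReal.toReal_ne_zero.2 ⟨hω, h2⟩) _

theorem mainTheorem4 {Ω : Type w} [MeasurableSpace Ω] (ν : Measure Ω) [IsProbabilityMeasure ν]
    [ν.IsComplete]
    {X : Type u} [NormedAddCommGroup X] [NormedSpace ℝ X] [CompleteSpace X]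
    {Y : Type v} [NormedAddCommGroup Y] [NormedSpace ℝ Y] [CompleteSpace Y]
    (T : X →L[ℝ] Y) (hT : IsSemiEmbedding T)
    (hX : IsWeaklyLindelofDetermined X) (hY : HasRadonNikodymProperty ν Y) :
    HasRadonNikodymProperty ν X := by
  intro m hmv hmν
  set μ := m.variation with hμ
  have : IsFiniteMeasure μ := ⟨hmv⟩
  have hμν : μ ≪ ν := VectorMeasure.variation_absolutelyContinuous hmν
  let Tm : VectorMeasure Ω Y := m.mapRange (T : X →+ Y) T.continuous
  have hTm : ∀ A, Tm A = T (m A) := fun A => VectorMeasure.mapRange_apply _ T.continuous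
  have hTmv : Tm.variation Set.univ < ⊤ := by
    have h1 : Tm.variation ≤ ‖T‖ₑ • μ := VectorMeasure.variation_le_of_forall_enorm_le fun A _ => by
      rw [hTm, Measure.smul_apply, smul_eq_mul]
      refine (T.le_opENorm (m A)).trans ?_
      gcongr
      exact VectorMeasure.enorm_measure_le_variation m A
    refine (h1 _).trans_lt ?_
    rw [Measure.smul_apply, smul_eq_mul]
    exact ENNReal.mul_lt_top enorm_lt_top hmv
  obtain ⟨g, hg, hgT⟩ := hY Tm hTmv fun A hA hA0 => by rw [hTm, hmν A hA hA0, map_zero]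
  have hgk := hg.ae_eq_rnDeriv_smul_inv_smul hμν fun A hA hA0 => by
    have h1 : m A = 0 := enorm_eq_zero.1
      (le_antisymm ((VectorMeasure.enorm_measure_le_variation m A).trans hA0.le) zero_le)
    rw [← hgT A hA, hTm, h1, map_zero]
  obtain ⟨f, hf, hmf⟩ := hT.exists_integrable_lift hX (m := m) (μ := μ)
    (k := fun ω => (μ.rnDeriv ν ω).toReal⁻¹ • g ω)
    (fun A => VectorMeasure.norm_measure_le_variation)
    ((integrable_rnDeriv_smul_iff hμν).1 (hg.congr hgk.symm)) fun A hA => by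
      rw [← hTm, hgT A hA, ← setIntegral_rnDeriv_smul hμν hA]
      exact integral_congr_ae (ae_restrict_of_ae hgk.symm)
  refine ⟨fun ω => (μ.rnDeriv ν ω).toReal • f ω, (integrable_rnDeriv_smul_iff hμν).2 hf,
    fun A hA => ?_⟩
  rw [hmf A hA, setIntegral_rnDeriv_smul hμν hA]
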